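/- Let $X$ be a topological space and $I=[0,1]$; the space $\mathcal P X$ of all paths $I\to X$ and all other mapping spaces carry the compact-open topology. A path $\alpha\in\mathcal P X$ is *well-ended* (respectively *locally well-ended*) if for every open neighborhood $U$ of $\alpha$ in $\mathcal P X$ there are open neighborhoods $V_0$ of $\alpha(0)$ and $V_1$ of $\alpha(1)$ in $X$ such that for all $a\in V_0$, $b\in V_1$ there is a path (respectively a well-ended path) $\beta\in U$ with $\beta(0)=a$, $\beta(1)=b$. The space $X$ is *locally wep-connected* if any two of its points are joined by a locally well-ended path. A *semicovering* of $X$ is a local homeomorphism $p\colon Y\to X$ such that for every $y\in Y$ composition with $p$ gives homeomorphisms $$\{\alpha\in\mathcal P Y:\alpha(0)=y\}\to\{\alpha\in\mathcal P X:\alpha(0)=p(y)\},$$ $$\{\phi\colon\Delta_2\to Y:\phi(0,t)=y\ \forall t\in I\}\to\{\phi\colon\Delta_2\to X:\phi(0,t)=p(y)\ \forall t\in I\},$$ where $\Delta_2=\{(s,t)\in I^2: s+t\le 1\}$ and the maps $\phi$ are continuous. It is *connected* if $Y$ is non-empty and path connected. A morphism from $p\colon Y\to X$ to $q\colon Z\to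 X$ is a continuous map $f\colon Y\to Z$ with $q\circ f=p$; two semicoverings are *equivalent* if they are isomorphic, i.e. if there is such an $f$ which is a homeomorphism. Let $\pi_1^\tau(X,x_0)$ be the fundamental group with the finest group topology for which the map from the loop space $\Omega(X,x_0)\to\pi_1(X,x_0)$, $\alpha\mapsto[\alpha]$, is continuous. **Corollary.** Let $X$ be a locally wep-connected space and $x_0\in X$. There is a Galois correspondence between equivalence classes of connected semicoverings of $X$ and conjugacy classes of open subgroups of $\pi_1^\tau(X,x_0)$. That is: for every connected semicovering $p\colon Y\to X$ the fiber $p^{-1}(x_0)$ is non-empty, for every $y\in p^{-1}(x_0)$ the subgroup $p_*\pi_1(Y,y)$ is open in $\pi_1^\tau(X,x_0)$, and sending the equivalence class of $p$ to the conjugacy class of $p_*\pi_1(Y,y)$ is a well-defined bijection, independent of the choice of $y$, from the set of equivalence classes of connected semicoverings of $X$ onto the set of conjugacy classes of open subgroups of $\pi_1^\tau(X,x_0)$. Moreover, if connected semicoverings $p$ and $q$ correspond to the conjugacy classes of $H$ and $K$, then there is a morphism of semicoverings from $p$ to $q$ if and only if $H\subseteq gKg^{-1}$ for some $g\in\pi_1^\tau(X,x_0)$.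 -/

import Mathlib

universe u v

/-! ## Path spaces, spaces of homotopies of paths, semicoverings -/

section Semicoverings

variable {X : Type u} [TopologicalSpace X] {Y : Type v} [TopologicalSpace Y]

/-- The space of all paths `[0,1] → X`, with the compact-open topology. -/
abbrev PathSpace (X : Type u) [TopologicalSpace X] : Type u := C(unitInterval, X)

/-- The space of paths in `X` starting at `x`, as a subspace of `PathSpace X`. -/
abbrev PathsFrom (x : X) : Type u := {α : PathSpace X // α 0 = x}

/-- The 2-simplex `{(s, t) ∈ [0,1]² | s + t ≤ 1}`. -/
abbrev Triangle : Type := {z : unitInterval × unitInterval // (z.1 : ℝ) + (z.2 : ℝ) ≤ 1}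

/-- The space of homotopies of paths starting at `x`: maps from the 2-simplex to `X` which
are constant at `x` on the edge `s = 0`, with (the subspace topology of) the compact-open
topology. -/
abbrev HomotopiesFrom (x : X) : Type u :=
  {φ : C(Triangle, X) // ∀ z : Triangle, z.1.1 = 0 → φ z = x}

/-- Composition with `p`, as a function from paths starting at `y` to paths starting
at `p y`. -/
def pathsMap (p : C(Y, X)) (y : Y) (α : PathsFrom y) : PathsFrom (p y) :=
  ⟨p.comp α.1, by rw [ContinuousMap.comp_apply, α.2]⟩

/-- Composition with `p`, as a function from homotopies of paths starting at `y` to homotopies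
of paths starting at `p y`. -/
def homotopiesMap (p : C(Y, X)) (y : Y) (φ : HomotopiesFrom y) : HomotopiesFrom (p y) :=
  ⟨p.comp φ.1, fun z hz => by rw [ContinuousMap.comp_apply, φ.2 z hz]⟩

/-- `p` has continuous lifting of paths. -/
def HasContinuousPathLifting (p : C(Y, X)) : Prop :=
  ∀ y : Y, IsHomeomorph (pathsMap p y)

/-- `p` has continuous lifting of homotopies. -/
def HasContinuousHomotopyLifting (p : C(Y, X)) : Prop :=
  ∀ y : Y, IsHomeomorph (homotopiesMap p y)

/-- A semicovering map: a local homeomorphism with continuous lifting of paths and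
homotopies. -/
structure IsSemicovering (p : C(Y, X)) : Prop where
  isLocalHomeomorph : IsLocalHomeomorph p
  pathLifting : HasContinuousPathLifting p
  homotopyLifting : HasContinuousHomotopyLifting p

end Semicoverings

/-- A connected semicovering of `X`: its total space is non-empty and path connected. -/
structure ConnectedSemicovering (X : Type u) [TopologicalSpace X] where
  /-- the total space -/
  space : Type u
  [topology : TopologicalSpace space]
  /-- the projection -/
  proj : C(space, X)
  isSemicovering : IsSemicovering proj
  pathConnected : PathConnectedSpace space

attribute [instance] ConnectedSemicovering.topology

namespace ConnectedSemicovering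

variable {X : Type u} [TopologicalSpace X]

/-- A morphism of semicoverings of `X`: a continuous map over `X`. -/
def Hom (p q : ConnectedSemicovering X) : Type u :=
  {f : C(p.space, q.space) // q.proj.comp f = p.proj}

/-- Two semicoverings of `X` are equivalent if there is a homeomorphism over `X` between them,
that is, if they are isomorphic in the category of semicoverings of `X`. -/
def Equivalent (p q : ConnectedSemicovering X) : Prop :=
  ∃ e : p.space ≃ₜ q.space, ∀ y, q.proj (e y) = p.proj y

/-- Equivalence of connected semicoverings of `X`, as a setoid. -/
instance equivalenceSetoid (X : Type u) [TopologicalSpace X] :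
    Setoid (ConnectedSemicovering X) where
  r := Equivalent
  iseqv :=
    { refl := fun p => ⟨Homeomorph.refl _, fun _ => rfl⟩
      symm := fun {p q} ⟨e, he⟩ => ⟨e.symm, fun y => by rw [← he, e.apply_symm_apply]⟩
      trans := fun {p q r} ⟨e, he⟩ ⟨f, hf⟩ =>
        ⟨e.trans f, fun y => by rw [Homeomorph.trans_apply, hf, he]⟩ }

/-- The equivalence classes of connected semicoverings of `X`. -/
abbrev EquivalenceClasses (X : Type u) [TopologicalSpace X] : Type (u + 1) :=
  Quotient (equivalenceSetoid X)

end ConnectedSemicovering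

/-! ## Locally wep-connected spaces -/

section Wep

variable {X : Type u} [TopologicalSpace X]

/-- A path `α` is well-ended if every neighborhood of `α` contains paths joining any two points
sufficiently near to the endpoints of `α`. -/
def IsWellEnded (α : PathSpace X) : Prop :=
  ∀ U : Set (PathSpace X), IsOpen U → α ∈ U →
    ∃ V₀ V₁ : Set X, IsOpen V₀ ∧ α 0 ∈ V₀ ∧ IsOpen V₁ ∧ α 1 ∈ V₁ ∧
      ∀ a ∈ V₀, ∀ b ∈ V₁, ∃ β ∈ U, β 0 = a ∧ β 1 = b

/-- A path `α` is locally well-ended if every neighborhood of `α` contains well-ended paths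
joining any two points sufficiently near to the endpoints of `α`. -/
def IsLocallyWellEnded (α : PathSpace X) : Prop :=
  ∀ U : Set (PathSpace X), IsOpen U → α ∈ U →
    ∃ V₀ V₁ : Set X, IsOpen V₀ ∧ α 0 ∈ V₀ ∧ IsOpen V₁ ∧ α 1 ∈ V₁ ∧
      ∀ a ∈ V₀, ∀ b ∈ V₁, ∃ β ∈ U, IsWellEnded β ∧ β 0 = a ∧ β 1 = b

/-- A space is locally wep-connected if any two points are joined by a locally well-ended
path. -/
def LocallyWepConnected (X : Type u) [TopologicalSpace X] : Prop :=
  ∀ x y : X, ∃ α : PathSpace X, IsLocallyWellEnded α ∧ α 0 = x ∧ α 1 = y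

end Wep

/-! ## The topological fundamental group and its open subgroups -/

section FundamentalGroupTopology

variable (X : Type u) [TopologicalSpace X] (x₀ : X)

/-- The topology of `π₁^τ(X, x₀)`: the finest group topology on the fundamental group for which
the map from the loop space (with the compact-open topology) sending a loop to its homotopy class
is continuous. -/
noncomputable def tauTopology : GroupTopology (FundamentalGroup X x₀) :=
  GroupTopology.coinduced
    (fun γ : Path x₀ x₀ => FundamentalGroup.fromPath (Path.Homotopic.Quotient.mk γ))

/-- Openness in `π₁^τ(X, x₀)`. -/
def IsTauOpen (S : Set (FundamentalGroup X x₀)) : Prop :=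
  @IsOpen (FundamentalGroup X x₀) (tauTopology X x₀).toTopologicalSpace S

/-- The open subgroups of `π₁^τ(X, x₀)`. -/
abbrev OpenSubgroups : Type u :=
  {H : Subgroup (FundamentalGroup X x₀) // IsTauOpen X x₀ (H : Set (FundamentalGroup X x₀))}

/-- Conjugacy of subgroups of a group: `K = g H g⁻¹` for some `g`. -/
def conjugateSubgroups (G : Type u) [Group G] : Setoid (Subgroup G) where
  r H K := ∃ g : G, K = H.map (MulAut.conj g).toMonoidHom
  iseqv :=
    { refl := fun H => ⟨1, by ext; simp⟩
      symm := fun {H K} ⟨g, hg⟩ => ⟨g⁻¹, by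
        rw [hg, Subgroup.map_map]; ext; simp [mul_assoc]⟩
      trans := fun {H K L} ⟨g, hg⟩ ⟨k, hk⟩ => ⟨k * g, by
        rw [hk, hg, Subgroup.map_map]; ext; simp [mul_assoc]⟩ }

/-- Conjugacy of open subgroups of `π₁^τ(X, x₀)`. -/
noncomputable instance conjugacySetoid : Setoid (OpenSubgroups X x₀) :=
  (conjugateSubgroups (FundamentalGroup X x₀)).comap Subtype.val

/-- The conjugacy classes of open subgroups of `π₁^τ(X, x₀)`. -/
abbrev OpenSubgroupConjClasses : Type u := Quotient (conjugacySetoid X x₀)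

end FundamentalGroupTopology

/-- For a point `y` over `x₀`, the image in `π₁(X, x₀)` of the fundamental group of the total space
at `y`. -/
noncomputable def ConnectedSemicovering.imageSubgroup {X : Type u} [TopologicalSpace X] {x₀ : X}
    (p : ConnectedSemicovering X) (y : p.space) (hy : p.proj y = x₀) :
    Subgroup (FundamentalGroup X x₀) :=
  (FundamentalGroup.mapOfEq p.proj hy).range

/-! Everything rests on the map sending a path from `x₀` to the endpoint of its lift. For a
semicovering `p` and a point `y` over `x₀`, lifts from `y` are unique and depend continuously on the
path, and their endpoints depend only on the homotopy class rel endpoints, because fibers are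
discrete (`LiftsTo.of_homotopic`). Hence `p_*π₁(Y, y)` consists of the classes of loops that lift to
loops at `y`; it is open, and moving `y` in the fiber conjugates it.

Morphisms: in a locally wep-connected space every path is homotopic to one whose endpoint can be
moved freely by small changes of the path. This makes the lift-endpoint map from paths to a path
connected `Y` a quotient map (`isQuotientMap_lift_end`), so an inclusion of image subgroups descends
to a continuous map over `X` (`exists_morphism`). Equal subgroups give mutually inverse morphisms.

Existence: given an open `H`, take paths from `x₀` modulo "same endpoint, and difference loop in
`H`". On pairs of paths with a common endpoint this relation is open because `H` is, and closed
because an open subgroup of a topological group is closed. Openness and local wep-connectedness make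
the endpoint projection a local homeomorphism (`exists_isOpen_sheet`); closedness makes it
separated, so lifts are unique. Classes of initial segments supply the lifts, and lifting a homotopy
row by row reduces it to paths.

Openness in `π₁^τ` can be tested on loops (`isTauOpen_iff`): a subgroup with an open set of loops is
open in the group topology given by the action on its cosets, and `π₁^τ` is at least as fine. -/

open scoped unitInterval Topology
open Filter

/-! ## Loop classes and open subgroups of `π₁^τ` -/

section LoopClass

variable {X : Type u} [TopologicalSpace X] {x₀ x : X}

/-- The class of a loop in the fundamental group. -/
abbrev loopClass (γ : Path x₀ x₀) : FundamentalGroup X x₀ :=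
  FundamentalGroup.fromPath (Path.Homotopic.Quotient.mk γ)

theorem loopClass_eq_iff {γ δ : Path x₀ x₀} : loopClass γ = loopClass δ ↔ γ.Homotopic δ :=
  Path.Homotopic.Quotient.eq

/-- Multiplication in `FundamentalGroup` is composition of automorphisms, hence opposite to
concatenation. -/
theorem loopClass_trans (γ δ : Path x₀ x₀) :
    loopClass (γ.trans δ) = loopClass δ * loopClass γ := rfl

theorem loopClass_symm (γ : Path x₀ x₀) : loopClass γ.symm = (loopClass γ)⁻¹ := rfl

theorem exists_loopClass_eq (g : FundamentalGroup X x₀) : ∃ γ : Path x₀ x₀, loopClass γ = g :=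
  Path.Homotopic.Quotient.mk_surjective g

theorem loopClass_trans_symm_self (a : Path x₀ x) : loopClass (a.trans a.symm) = 1 := by
  have : Path.Homotopic.Quotient.mk (a.trans a.symm) = .refl x₀ := by simp
  exact this

theorem loopClass_trans_symm_inv (a b : Path x₀ x) :
    (loopClass (a.trans b.symm))⁻¹ = loopClass (b.trans a.symm) := by
  rw [← loopClass_symm, Path.trans_symm, Path.symm_symm]

theorem loopClass_trans_symm_mul (a b c : Path x₀ x) :
    loopClass (b.trans c.symm) * loopClass (a.trans b.symm) = loopClass (a.trans c.symm) := by
  rw [← loopClass_trans]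
  refine Path.Homotopic.Quotient.eq.1 ?_ |> loopClass_eq_iff.2
  simp only [Path.Homotopic.Quotient.mk_trans, Path.Homotopic.Quotient.mk_symm,
    Path.Homotopic.Quotient.trans_assoc]
  rw [← Path.Homotopic.Quotient.trans_assoc (Path.Homotopic.Quotient.mk b).symm]
  simp

end LoopClass

/-! ### The group topology of pointwise convergence on a discrete coset space. -/

section CosetTopology

variable {G : Type u} [Group G]

/-- The topology on a group generated by the cosets of the conjugates of a subgroup. -/
abbrev cosetTopologicalSpace (H : Subgroup G) : TopologicalSpace G :=
  ⨅ a : G, TopologicalSpace.induced (fun g => ((g * a : G) : G ⧸ H)) ⊥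

theorem eventually_coset_eq (H : Subgroup G) (a g₀ : G) :
    ∀ᶠ g in @nhds G (cosetTopologicalSpace H) g₀,
      ((g * a : G) : G ⧸ H) = ((g₀ * a : G) : G ⧸ H) := by
  let _ : TopologicalSpace (G ⧸ H) := ⊥
  let _ : TopologicalSpace G := cosetTopologicalSpace H
  have _ : DiscreteTopology (G ⧸ H) := ⟨rfl⟩
  have hc : Continuous (fun g : G => ((g * a : G) : G ⧸ H)) :=
    continuous_iff_le_induced.2 (iInf_le _ a)
  exact hc.continuousAt.eventually (p := fun z => z = ((g₀ * a : G) : G ⧸ H)) (by simp)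

theorem continuous_cosetTopologicalSpace {Z : Type*} [TopologicalSpace Z] (H : Subgroup G)
    (F : Z → G)
    (h : ∀ (a : G) (z₀ : Z), ∀ᶠ z in 𝓝 z₀, ((F z * a : G) : G ⧸ H) = ((F z₀ * a : G) : G ⧸ H)) :
    @Continuous Z G _ (cosetTopologicalSpace H) F := by
  refine continuous_iInf_rng.2 fun a => continuous_induced_rng.2 ?_
  let _ : TopologicalSpace (G ⧸ H) := ⊥
  have _ : DiscreteTopology (G ⧸ H) := ⟨rfl⟩
  exact continuous_iff_continuousAt.2 fun z₀ => tendsto_nhds_of_eventually_eq (h a z₀)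

/-- The group topology generated by the cosets of the conjugates of a subgroup. -/
def cosetGroupTopology (H : Subgroup G) : GroupTopology G where
  toTopologicalSpace := cosetTopologicalSpace H
  continuous_mul := by
    let _ : TopologicalSpace G := cosetTopologicalSpace H
    refine continuous_cosetTopologicalSpace H _ fun a ⟨g₀, h₀⟩ => ?_
    rw [nhds_prod_eq]
    -- `ghaH = gh₀aH = g₀h₀aH`: the left factor is tested on the coset of `h₀a`, so the coset of `1`
    -- alone would not suffice.
    filter_upwards [(eventually_coset_eq H (h₀ * a) g₀).prod_inl _,
      (eventually_coset_eq H a h₀).prod_inr _] with ⟨g, h⟩ hg hh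
    rw [QuotientGroup.eq] at *
    simp only at *
    convert H.mul_mem hh hg using 1
    group
  continuous_inv := by
    let _ : TopologicalSpace G := cosetTopologicalSpace H
    refine continuous_cosetTopologicalSpace H _ fun a g₀ => ?_
    -- Apply `g⁻¹` to `g(g₀⁻¹a)H = aH`.
    filter_upwards [eventually_coset_eq H (g₀⁻¹ * a) g₀] with g hg
    rw [QuotientGroup.eq] at *
    convert H.inv_mem hg using 1
    group

theorem isOpen_cosetGroupTopology (H : Subgroup G) :
    @IsOpen G (cosetGroupTopology H).toTopologicalSpace (H : Set G) := by
  let _ : TopologicalSpace G := cosetTopologicalSpace H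
  refine (isOpen_iff_mem_nhds (X := G)).2 fun g hg => ?_
  filter_upwards [eventually_coset_eq H 1 g] with k hk
  rw [QuotientGroup.eq, mul_one, mul_one] at hk
  simpa using H.mul_mem hg (H.inv_mem hk)

end CosetTopology

/-! ### Testing openness of subgroups on loops. -/

section TauOpen

variable {X : Type u} [TopologicalSpace X] {x₀ : X}

theorem continuous_loopClass :
    @Continuous _ _ _ (tauTopology X x₀).toTopologicalSpace (loopClass (x₀ := x₀)) :=
  GroupTopology.coinduced_continuous _

/-- A subgroup is open in `π₁^τ(X, x₀)` if and only if the loops representing its elements form an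
open set. -/
theorem isTauOpen_iff (H : Subgroup (FundamentalGroup X x₀)) :
    IsTauOpen X x₀ (H : Set (FundamentalGroup X x₀)) ↔
      IsOpen {γ : Path x₀ x₀ | loopClass γ ∈ H} := by
  constructor
  · intro h
    exact (continuous_def.1 continuous_loopClass) _ h
  · intro h
    have hle : tauTopology X x₀ ≤ cosetGroupTopology H := by
      refine sInf_le (continuous_iff_coinduced_le.1 ?_)
      refine continuous_cosetTopologicalSpace H _ fun g γ₀ => ?_
      obtain ⟨a, rfl⟩ := exists_loopClass_eq g
      -- In the group this loop is `[a.trans γ₀]⁻¹ * [a.trans γ]`; its membership in `H` is the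
      -- required equality of left cosets.
      have hc : Continuous fun γ : Path x₀ x₀ => (a.trans γ).trans (a.trans γ₀).symm :=
        (continuous_const.path_trans continuous_id).path_trans continuous_const
      have hmem : γ₀ ∈ {γ : Path x₀ x₀ | loopClass ((a.trans γ).trans (a.trans γ₀).symm) ∈ H} := by
        rw [Set.mem_ofPred_eq, loopClass_trans_symm_self]; exact H.one_mem
      filter_upwards [(h.preimage hc).mem_nhds hmem] with γ hγ
      rw [QuotientGroup.eq]
      have hγ' := H.inv_mem hγ
      rwa [loopClass_trans_symm_inv] at hγ'
    exact hle _ (isOpen_cosetGroupTopology H)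

theorem isTauClosed_of_isTauOpen (H : Subgroup (FundamentalGroup X x₀))
    (h : IsTauOpen X x₀ (H : Set (FundamentalGroup X x₀))) :
    IsOpen {γ : Path x₀ x₀ | loopClass γ ∉ H} := by
  let _ := (tauTopology X x₀).toTopologicalSpace
  have := (tauTopology X x₀).toIsTopologicalGroup
  exact (H.isClosed_of_isOpen h).isOpen_compl.preimage continuous_loopClass

end TauOpen

/-! ## Path lifting for semicoverings -/

section Lifting

variable {X : Type u} [TopologicalSpace X] {Y : Type v} [TopologicalSpace Y] {p : C(Y, X)}

/-- The path `γ` lifts along `p` to a path from `y` to `y'`. -/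
def LiftsTo (p : C(Y, X)) (γ : I → X) (y y' : Y) : Prop :=
  ∃ γ' : Path y y', ∀ t, p (γ' t) = γ t

theorem liftsTo_map (p : C(Y, X)) {y y' : Y} (γ : Path y y') :
    LiftsTo p (γ.map p.continuous) y y' :=
  ⟨γ, fun _ => rfl⟩

namespace LiftsTo

variable {y y' y'' : Y} {a b c : X}

theorem symm {γ : Path a b} (h : LiftsTo p γ y y') : LiftsTo p γ.symm y' y :=
  let ⟨γ', h⟩ := h
  ⟨γ'.symm, fun t => h (σ t)⟩

theorem trans {γ : Path a b} {δ : Path b c} (hγ : LiftsTo p γ y y') (hδ : LiftsTo p δ y' y'') :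
    LiftsTo p (γ.trans δ) y y'' := by
  obtain ⟨γ', hγ⟩ := hγ
  obtain ⟨δ', hδ⟩ := hδ
  refine ⟨γ'.trans δ', fun t => ?_⟩
  rw [Path.trans_apply, Path.trans_apply]
  split_ifs
  · exact hγ _
  · exact hδ _

theorem proj_source {γ : Path a b} (h : LiftsTo p γ y y') : p y = a := by
  obtain ⟨γ', h⟩ := h
  simpa using h 0

theorem proj_target {γ : Path a b} (h : LiftsTo p γ y y') : p y' = b := by
  obtain ⟨γ', h⟩ := h
  simpa using h 1

theorem comp {Z : Type*} [TopologicalSpace Z] {q : C(Z, X)} {f : C(Y, Z)} (hf : q.comp f = p)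
    {γ : I → X} (h : LiftsTo p γ y y') : LiftsTo q γ (f y) (f y') := by
  obtain ⟨γ', h⟩ := h
  subst hf
  exact ⟨γ'.map f.continuous, h⟩

theorem target_unique (hp : HasContinuousPathLifting p) {γ : I → X} (h : LiftsTo p γ y y')
    (h' : LiftsTo p γ y y'') : y' = y'' := by
  obtain ⟨α, hα⟩ := h
  obtain ⟨β, hβ⟩ := h'
  have := (hp y).injective (a₁ := ⟨α.toContinuousMap, α.source⟩)
    (a₂ := ⟨β.toContinuousMap, β.source⟩)
    (Subtype.ext (ContinuousMap.ext fun t => (hα t).trans (hβ t).symm))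
  simpa using congrArg (fun φ : PathsFrom y => φ.1 1) this

end LiftsTo

/-- The endpoint of the lift with prescribed starting point depends continuously on the path. -/
theorem exists_continuous_lift_end (hp : HasContinuousPathLifting p) {x : X} {y : Y}
    (hy : p y = x) :
    ∃ e : PathsFrom x → Y, Continuous e ∧ ∀ α : PathsFrom x, LiftsTo p α.1 y (e α) := by
  subst hy
  let h := (hp y).homeomorph
  refine ⟨fun α => (h.symm α).1 1, by fun_prop, fun α => ?_⟩
  refine ⟨⟨(h.symm α).1, (h.symm α).2, rfl⟩, fun t => ?_⟩
  exact congrArg (fun φ : PathsFrom (p y) => φ.1 t) (h.apply_symm_apply α)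

theorem exists_liftsTo (hp : HasContinuousPathLifting p) {a b : X} (γ : Path a b) {y : Y}
    (hy : p y = a) : ∃ y', p y' = b ∧ LiftsTo p γ y y' := by
  obtain ⟨e, -, he⟩ := exists_continuous_lift_end hp hy
  have := he ⟨γ.toContinuousMap, γ.source⟩
  exact ⟨_, LiftsTo.proj_target (γ := γ) this, this⟩

/-- Local injectivity makes the fibers discrete, so a map from a connected space into a fiber is
constant. -/
theorem eq_of_continuous_of_proj_const (hp : IsLocallyInjective p) {T : Type*} [TopologicalSpace T]
    [PreconnectedSpace T] {g : T → Y} (hg : Continuous g) {x : X} (h : ∀ t, p (g t) = x) (s t : T) :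
    g s = g t := by
  refine IsLocallyConstant.apply_eq_of_preconnectedSpace
    ((IsLocallyConstant.iff_eventually_eq g).2 fun t => ?_) s t
  obtain ⟨U, hU, ht, hi⟩ := hp (g t)
  filter_upwards [(hU.preimage hg).mem_nhds ht] with s hs
  exact hi hs ht ((h s).trans (h t).symm)

/-- A homotopy is a continuous curve of paths; the endpoints of their lifts move continuously inside
the fiber over `b`, hence do not move. -/
theorem LiftsTo.of_homotopic (hp : IsSemicovering p) {a b : X} {γ δ : Path a b}
    (hγδ : γ.Homotopic δ) {y y' : Y} (h : LiftsTo p γ y y') : LiftsTo p δ y y' := by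
  obtain ⟨F⟩ := hγδ
  obtain ⟨e, he, hl⟩ := exists_continuous_lift_end hp.pathLifting h.proj_source
  let A : I → PathsFrom a := fun t => ⟨(F.eval t).toContinuousMap, (F.eval t).source⟩
  have hA : Continuous A := by
    refine Continuous.subtype_mk (ContinuousMap.continuous_of_continuous_uncurry _ ?_) _
    exact F.continuous
  have h01 := eq_of_continuous_of_proj_const hp.isLocalHomeomorph.isLocallyInjective
    (he.comp hA) (x := b) (fun t => LiftsTo.proj_target (γ := F.eval t) (hl (A t))) 0 1
  have h0 : LiftsTo p γ y (e (A 0)) := by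
    obtain ⟨l, hl⟩ := hl (A 0)
    exact ⟨l, fun t => (hl t).trans (F.apply_zero t)⟩
  have h1 : LiftsTo p δ y (e (A 1)) := by
    obtain ⟨l, hl⟩ := hl (A 1)
    exact ⟨l, fun t => (hl t).trans (F.apply_one t)⟩
  rw [h.target_unique hp.pathLifting h0]
  rwa [show e (A 0) = e (A 1) from h01]

end Lifting

/-! ## Paths whose endpoint can be moved -/

section OpenAt

variable {P : Type*} [TopologicalSpace P] {X : Type*} [TopologicalSpace X]

/-- The map `e` is open at the point `α`. -/
def IsOpenMapAt (e : P → X) (α : P) : Prop :=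
  ∀ A ∈ 𝓝 α, ∀ᶠ b in 𝓝 (e α), ∃ β ∈ A, e β = b

/-- Every neighborhood of `α` meets the fibers of `e` near `α` in points at which `e` is open. -/
def IsLocallyOpenMapAt (e : P → X) (α : P) : Prop :=
  ∀ A ∈ 𝓝 α, ∀ᶠ b in 𝓝 (e α), ∃ β ∈ A, IsOpenMapAt e β ∧ e β = b

theorem IsLocallyOpenMapAt.isOpenMapAt {e : P → X} {α : P} (h : IsLocallyOpenMapAt e α) :
    IsOpenMapAt e α := fun A hA => (h A hA).mono fun _ ⟨β, hβ, _, hb⟩ => ⟨β, hβ, hb⟩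

end OpenAt

section PathsFrom

variable {X : Type u} [TopologicalSpace X] {x₀ x : X}

/-- The endpoint of a path. -/
def pathEnd (α : PathsFrom x₀) : X := α.1 1

theorem continuous_pathEnd : Continuous (pathEnd (x₀ := x₀)) := by
  unfold pathEnd
  fun_prop

/-- A path with fixed endpoints, as an element of the space of paths from its source. -/
def Path.toPathsFrom (γ : Path x₀ x) : PathsFrom x₀ := ⟨γ.toContinuousMap, γ.source⟩

/-- An element of the space of paths from `x₀`, as a path with fixed endpoints. -/
def pathOf (α : PathsFrom x₀) (h : pathEnd α = x) : Path x₀ x := ⟨α.1, α.2, h⟩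

theorem continuous_toPathsFrom {ι : Type*} [TopologicalSpace ι] {f : ι → X}
    {g : ∀ i, Path x₀ (f i)} (hg : Continuous ↿g) : Continuous fun i => (g i).toPathsFrom :=
  Continuous.subtype_mk (ContinuousMap.continuous_of_continuous_uncurry _ hg) _

theorem continuous_pathOf {ι : Type*} [TopologicalSpace ι] {f : ι → X} {g : ι → PathsFrom x₀}
    (hg : Continuous g) (h : ∀ i, pathEnd (g i) = f i) :
    Continuous ↿fun i => pathOf (g i) (h i) := by
  change Continuous fun z : ι × I => (g z.1).1 z.2
  fun_prop

/-- Extending paths at their source by a fixed path. -/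
noncomputable def prependPath (δ : Path x₀ x) (β : PathsFrom x) : PathsFrom x₀ :=
  (δ.trans (pathOf β rfl)).toPathsFrom

theorem continuous_prependPath (δ : Path x₀ x) : Continuous (prependPath δ) :=
  continuous_toPathsFrom <| Path.trans_continuous_family _ (by
    change Continuous fun z : PathsFrom x × I => δ z.2
    fun_prop) _ (continuous_pathOf continuous_id _)

theorem pathEnd_prependPath (δ : Path x₀ x) (β : PathsFrom x) :
    pathEnd (prependPath δ β) = pathEnd β :=
  (δ.trans (pathOf β rfl)).target

theorem IsWellEnded.eventually {β : PathsFrom x} (h : IsWellEnded β.1) {A : Set (PathsFrom x)}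
    (hA : A ∈ 𝓝 β) : ∀ᶠ b in 𝓝 (pathEnd β), ∃ γ ∈ A, pathEnd γ = b := by
  obtain ⟨A', hA', hAo, hβ⟩ := mem_nhds_iff.1 hA
  obtain ⟨U, hU, rfl⟩ := isOpen_induced_iff.1 hAo
  obtain ⟨V₀, V₁, -, h₀, hV₁, h₁, H⟩ := h U hU hβ
  filter_upwards [hV₁.mem_nhds h₁] with b hb
  obtain ⟨γ, hγ, hx, hb⟩ := H x (by simpa only [β.2] using h₀) b hb
  exact ⟨⟨γ, hx⟩, hA' hγ, hb⟩

theorem IsLocallyWellEnded.eventually {β : PathsFrom x} (h : IsLocallyWellEnded β.1)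
    {A : Set (PathsFrom x)} (hA : A ∈ 𝓝 β) :
    ∀ᶠ b in 𝓝 (pathEnd β), ∃ γ ∈ A, IsWellEnded γ.1 ∧ pathEnd γ = b := by
  obtain ⟨A', hA', hAo, hβ⟩ := mem_nhds_iff.1 hA
  obtain ⟨U, hU, rfl⟩ := isOpen_induced_iff.1 hAo
  obtain ⟨V₀, V₁, -, h₀, hV₁, h₁, H⟩ := h U hU hβ
  filter_upwards [hV₁.mem_nhds h₁] with b hb
  obtain ⟨γ, hγ, hw, hx, hb⟩ := H x (by simpa only [β.2] using h₀) b hb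
  exact ⟨⟨γ, hx⟩, hA' hγ, hw, hb⟩

/-- Only the far endpoint has to move, so an arbitrary initial piece does no harm. -/
theorem IsWellEnded.isOpenMapAt_prependPath {β : PathsFrom x} (h : IsWellEnded β.1)
    (δ : Path x₀ x) : IsOpenMapAt pathEnd (prependPath δ β) := by
  intro A hA
  rw [pathEnd_prependPath]
  filter_upwards [h.eventually ((continuous_prependPath δ).continuousAt hA)] with b ⟨γ, hγ, hb⟩
  exact ⟨_, hγ, (pathEnd_prependPath δ γ).trans hb⟩

theorem IsLocallyWellEnded.isLocallyOpenMapAt_prependPath {β : PathsFrom x}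
    (h : IsLocallyWellEnded β.1) (δ : Path x₀ x) :
    IsLocallyOpenMapAt pathEnd (prependPath δ β) := by
  intro A hA
  rw [pathEnd_prependPath]
  filter_upwards [h.eventually ((continuous_prependPath δ).continuousAt hA)] with b ⟨γ, hγ, hw, hb⟩
  exact ⟨_, hγ, hw.isOpenMapAt_prependPath δ, (pathEnd_prependPath δ γ).trans hb⟩

theorem LocallyWepConnected.pathConnectedSpace (hX : LocallyWepConnected X) (x₀ : X) :
    PathConnectedSpace X where
  nonempty := ⟨x₀⟩
  joined x y := by
    obtain ⟨α, -, h₀, h₁⟩ := hX x y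
    exact ⟨⟨α, h₀, h₁⟩⟩

theorem LocallyWepConnected.exists_homotopic (hX : LocallyWepConnected X) (γ : Path x₀ x) :
    ∃ γ' : Path x₀ x, γ.Homotopic γ' ∧ IsLocallyOpenMapAt pathEnd γ'.toPathsFrom := by
  obtain ⟨α, hα, h₀, h₁⟩ := hX x₀ x
  let β : PathsFrom x₀ := ⟨α, h₀⟩
  let b : Path x₀ x := pathOf β h₁
  -- Insert a detour so that the path finishes with the locally well-ended `b`.
  refine ⟨(γ.trans b.symm).trans b, Path.Homotopic.Quotient.eq.1 (by simp), ?_⟩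
  exact IsLocallyWellEnded.isLocallyOpenMapAt_prependPath (β := β) hα (γ.trans b.symm)

end PathsFrom

/-! ## Morphisms of semicoverings -/

section Morphisms

variable {X : Type u} [TopologicalSpace X] {Y : Type v} [TopologicalSpace Y] {p : C(Y, X)}
  {x₀ : X}

/-- Each point of `Y` is `e α` for a path `α` at which `pathEnd` is open. A nearby point of `Y` then
has the same projection as `e β` for some `β` near `α`, and local injectivity identifies the two. -/
theorem isQuotientMap_lift_end (hX : LocallyWepConnected X) (hp : IsSemicovering p)
    [PathConnectedSpace Y] {y : Y} {e : PathsFrom x₀ → Y} (he : Continuous e)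
    (hl : ∀ α : PathsFrom x₀, LiftsTo p α.1 y (e α)) : Topology.IsQuotientMap e := by
  have hy : p y = x₀ := (hl ⟨.const I x₀, rfl⟩).proj_source (γ := Path.refl x₀)
  subst hy
  have hend : ∀ α, p (e α) = pathEnd α := fun α => LiftsTo.proj_target (γ := pathOf α rfl) (hl α)
  have key : ∀ y' : Y, ∃ α, e α = y' ∧ IsOpenMapAt pathEnd α := fun y' => by
    obtain ⟨γ⟩ := PathConnectedSpace.joined y y'
    obtain ⟨γ', hh, ho⟩ := hX.exists_homotopic (γ.map p.continuous)
    exact ⟨_, (hl _).target_unique hp.pathLifting ((liftsTo_map p γ).of_homotopic hp hh),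
      ho.isOpenMapAt⟩
  refine (Topology.isQuotientMap_iff _).2 ⟨Topology.isCoinducing_iff.2 fun s =>
    ⟨fun hs => isOpen_iff_mem_nhds.2 fun y' hy' => ?_, fun h => h.preimage he⟩,
    fun y' => (key y').imp fun _ h => h.1⟩
  obtain ⟨α, rfl, hα⟩ := key y'
  obtain ⟨W, hW, hαW, hi⟩ := hp.isLocalHomeomorph.isLocallyInjective (e α)
  have hA := hα _ (inter_mem (hs.mem_nhds hy') ((hW.preimage he).mem_nhds hαW))
  rw [← hend] at hA
  filter_upwards [p.continuous.continuousAt.eventually hA, hW.mem_nhds hαW] with y'' ⟨β, hβ, hb⟩ hw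
  rw [← hi hβ.2 hw ((hend β).trans hb)]
  exact hβ.1

theorem exists_morphism {Z : Type*} [TopologicalSpace Z] {q : C(Z, X)}
    (hX : LocallyWepConnected X) (hp : IsSemicovering p) (hq : IsSemicovering q)
    [PathConnectedSpace Y] {y : Y} {z : Z} (hy : p y = x₀) (hz : q z = x₀)
    (h : ∀ γ : Path x₀ x₀, LiftsTo p γ y y → LiftsTo q γ z z) :
    ∃ f : C(Y, Z), q.comp f = p ∧ f y = z := by
  obtain ⟨e, he, hl⟩ := exists_continuous_lift_end hp.pathLifting hy
  obtain ⟨e', he', hl'⟩ := exists_continuous_lift_end hq.pathLifting hz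
  have hquot : Topology.IsQuotientMap (⟨e, he⟩ : C(PathsFrom x₀, Y)) :=
    isQuotientMap_lift_end hX hp he hl
  have hend : ∀ α, p (e α) = pathEnd α := fun α => LiftsTo.proj_target (γ := pathOf α rfl) (hl α)
  have hend' : ∀ α, q (e' α) = pathEnd α := fun α => LiftsTo.proj_target (γ := pathOf α rfl) (hl' α)
  -- The loop along `α` and back along `β` closes up at `y`, hence at `z`; following it by `β` gives
  -- a path homotopic to `α`, whose lift ends at `e' β`.
  have hfac : ∀ ⦃α β⦄, e α = e β → e' α = e' β := fun α β hαβ => by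
    have hβ : pathEnd β = pathEnd α := by rw [← hend, ← hend, hαβ]
    let a := pathOf α rfl
    let b := pathOf β hβ
    have ha : LiftsTo p a y (e α) := hl α
    have hb : LiftsTo p b y (e α) := hαβ ▸ hl β
    have hb' : LiftsTo q b z (e' β) := hl' β
    have hab := (h _ (ha.trans hb.symm)).trans hb'
    have hh : ((a.trans b.symm).trans b).Homotopic a := Path.Homotopic.Quotient.eq.1 (by simp)
    exact (hl' α).target_unique hq.pathLifting (hab.of_homotopic hq hh)
  let f : C(Y, Z) := hquot.lift ⟨e', he'⟩ hfac
  have hf : ∀ α, f (e α) = e' α := fun α =>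
    congrArg (fun φ : C(PathsFrom x₀, Z) => φ α) (hquot.lift_comp ⟨e', he'⟩ hfac)
  refine ⟨f, ContinuousMap.ext fun y' => ?_, ?_⟩
  · obtain ⟨α, rfl⟩ := hquot.surjective y'
    change q (f (e α)) = p (e α)
    rw [hf, hend, hend']
  · let c : PathsFrom x₀ := ⟨.const I x₀, rfl⟩
    have h1 : e c = y := (hl c).target_unique hp.pathLifting ⟨Path.refl y, fun _ => hy⟩
    have h2 : e' c = z := (hl' c).target_unique hq.pathLifting ⟨Path.refl z, fun _ => hz⟩
    rw [← h1, hf, h2]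

theorem morphism_unique {Z : Type*} [TopologicalSpace Z] {q : C(Z, X)}
    (hq : HasContinuousPathLifting q) [PathConnectedSpace Y] {f g : C(Y, Z)} (hf : q.comp f = p)
    (hg : q.comp g = p) {y : Y} (h : f y = g y) : f = g := by
  ext y'
  obtain ⟨γ⟩ := PathConnectedSpace.joined y y'
  have h1 := (liftsTo_map p γ).comp hf
  have h2 := (liftsTo_map p γ).comp hg
  rw [← h] at h2
  exact h1.target_unique hq h2

end Morphisms

/-! ### Image subgroups, and what they say about morphisms. -/

namespace ConnectedSemicovering

variable {X : Type u} [TopologicalSpace X] {x₀ : X}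

attribute [instance] ConnectedSemicovering.pathConnected

theorem loopClass_mem_imageSubgroup (p : ConnectedSemicovering X) {y : p.space}
    (hy : p.proj y = x₀) {γ : Path x₀ x₀} :
    loopClass γ ∈ p.imageSubgroup y hy ↔ LiftsTo p.proj γ y y := by
  subst hy
  constructor
  · rintro ⟨g, hg⟩
    obtain ⟨γ', rfl⟩ := exists_loopClass_eq g
    rw [FundamentalGroup.mapOfEq_apply] at hg
    have hh : (γ'.map p.proj.continuous).Homotopic γ := loopClass_eq_iff.1 hg
    exact (liftsTo_map p.proj γ').of_homotopic p.isSemicovering hh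
  · rintro ⟨γ', hγ'⟩
    refine ⟨loopClass γ', ?_⟩
    rw [FundamentalGroup.mapOfEq_apply]
    have : γ'.map p.proj.continuous = γ := Path.ext (funext hγ')
    rw [← this]
    rfl

theorem isTauOpen_imageSubgroup (p : ConnectedSemicovering X) {y : p.space}
    (hy : p.proj y = x₀) :
    IsTauOpen X x₀ (p.imageSubgroup y hy : Set (FundamentalGroup X x₀)) := by
  rw [isTauOpen_iff]
  obtain ⟨e, he, hl⟩ := exists_continuous_lift_end p.isSemicovering.pathLifting hy
  obtain ⟨W, hW, hyW, hi⟩ := p.isSemicovering.isLocalHomeomorph.isLocallyInjective y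
  have hc : Continuous fun γ : Path x₀ x₀ => e γ.toPathsFrom :=
    he.comp (continuous_toPathsFrom (Path.continuous_uncurry_iff.2 continuous_id))
  -- On a neighborhood `W` of `y` where `p` is injective, a lift ending in `W` over `x₀` must end at
  -- `y`.
  convert hW.preimage hc using 1
  ext γ
  have hγ : LiftsTo p.proj γ y (e γ.toPathsFrom) := hl _
  simp only [Set.mem_ofPred_eq, Set.mem_preimage, loopClass_mem_imageSubgroup]
  constructor
  · intro h
    rwa [← h.target_unique p.isSemicovering.pathLifting hγ]
  · intro h
    have : e γ.toPathsFrom = y := hi h hyW (hγ.proj_target.trans hy.symm)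
    rwa [this] at hγ

theorem imageSubgroup_le_iff (p q : ConnectedSemicovering X) {y : p.space} (hy : p.proj y = x₀)
    {z : q.space} (hz : q.proj z = x₀) : p.imageSubgroup y hy ≤ q.imageSubgroup z hz ↔
      ∀ γ : Path x₀ x₀, LiftsTo p.proj γ y y → LiftsTo q.proj γ z z := by
  simp only [← loopClass_mem_imageSubgroup _ hy, ← loopClass_mem_imageSubgroup _ hz]
  refine ⟨fun h γ hγ => h hγ, fun h g hg => ?_⟩
  obtain ⟨γ, rfl⟩ := exists_loopClass_eq g
  exact h γ hg

theorem exists_hom_iff (hX : LocallyWepConnected X) (p q : ConnectedSemicovering X) {y : p.space}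
    (hy : p.proj y = x₀) {z : q.space} (hz : q.proj z = x₀) :
    (∃ f : C(p.space, q.space), q.proj.comp f = p.proj ∧ f y = z) ↔
      p.imageSubgroup y hy ≤ q.imageSubgroup z hz := by
  rw [imageSubgroup_le_iff]
  refine ⟨?_, exists_morphism hX p.isSemicovering q.isSemicovering hy hz⟩
  rintro ⟨f, hf, rfl⟩ γ hγ
  exact hγ.comp hf

theorem equivalent_of_imageSubgroup_eq (hX : LocallyWepConnected X) (p q : ConnectedSemicovering X)
    {y : p.space} (hy : p.proj y = x₀) {z : q.space} (hz : q.proj z = x₀)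
    (h : p.imageSubgroup y hy = q.imageSubgroup z hz) : Equivalent p q := by
  obtain ⟨f, hf, hfy⟩ := (exists_hom_iff hX p q hy hz).2 h.le
  obtain ⟨g, hg, hgz⟩ := (exists_hom_iff hX q p hz hy).2 h.ge
  have hgf : g.comp f = .id _ := morphism_unique (p := p.proj) (q := p.proj) (y := y)
    p.isSemicovering.pathLifting (by rw [← ContinuousMap.comp_assoc, hg, hf]) rfl
    (by simp [hfy, hgz])
  have hfg : f.comp g = .id _ := morphism_unique (p := q.proj) (q := q.proj) (y := z)
    q.isSemicovering.pathLifting (by rw [← ContinuousMap.comp_assoc, hf, hg]) rfl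
    (by simp [hfy, hgz])
  exact ⟨⟨⟨f, g, DFunLike.congr_fun hgf, DFunLike.congr_fun hfg⟩, f.continuous, g.continuous⟩,
    DFunLike.congr_fun hf⟩

theorem exists_proj_eq (hX : LocallyWepConnected X) (p : ConnectedSemicovering X) (x₀ : X) :
    ∃ y, p.proj y = x₀ := by
  obtain ⟨y⟩ := p.pathConnected.nonempty
  have := hX.pathConnectedSpace x₀
  obtain ⟨y', h, -⟩ := exists_liftsTo p.isSemicovering.pathLifting
    (PathConnectedSpace.somePath (p.proj y) x₀) rfl
  exact ⟨y', h⟩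

/-- A loop `δ` closes up at `y'` exactly when `γ`, `δ`, `γ` reversed, run in this order, closes up
at `y`. -/
theorem imageSubgroup_eq_map_conj (p : ConnectedSemicovering X) {y y' : p.space}
    (hy : p.proj y = x₀) (hy' : p.proj y' = x₀) {γ : Path x₀ x₀} (h : LiftsTo p.proj γ y y') :
    p.imageSubgroup y' hy' =
      (p.imageSubgroup y hy).map (MulAut.conj (loopClass γ)).toMonoidHom := by
  ext g
  obtain ⟨δ, rfl⟩ := exists_loopClass_eq g
  rw [Subgroup.mem_map_equiv, MulAut.conj_symm_apply, ← loopClass_symm, mul_assoc,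
    ← loopClass_trans, ← loopClass_trans, loopClass_mem_imageSubgroup, loopClass_mem_imageSubgroup]
  refine ⟨fun hδ => (h.trans hδ).trans h.symm, fun hδ => ?_⟩
  refine ((h.symm.trans hδ).trans h).of_homotopic p.isSemicovering
    (Path.Homotopic.Quotient.eq.1 ?_)
  simp only [Path.Homotopic.Quotient.mk_trans, Path.Homotopic.Quotient.mk_symm,
    Path.Homotopic.Quotient.trans_assoc]
  rw [← Path.Homotopic.Quotient.trans_assoc (Path.Homotopic.Quotient.mk γ).symm]
  simp

theorem exists_imageSubgroup_eq_map_conj (p : ConnectedSemicovering X) {y y' : p.space}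
    (hy : p.proj y = x₀) (hy' : p.proj y' = x₀) : ∃ g : FundamentalGroup X x₀,
      p.imageSubgroup y' hy' = (p.imageSubgroup y hy).map (MulAut.conj g).toMonoidHom := by
  obtain ⟨γ⟩ := PathConnectedSpace.joined y y'
  exact ⟨_, p.imageSubgroup_eq_map_conj hy hy'
    (γ := (γ.map p.proj.continuous).cast hy.symm hy'.symm) (liftsTo_map p.proj γ)⟩

theorem exists_map_conj_eq_imageSubgroup (p : ConnectedSemicovering X) {y : p.space}
    (hy : p.proj y = x₀) (g : FundamentalGroup X x₀) : ∃ (y' : p.space) (hy' : p.proj y' = x₀),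
      p.imageSubgroup y' hy' = (p.imageSubgroup y hy).map (MulAut.conj g).toMonoidHom := by
  obtain ⟨γ, rfl⟩ := exists_loopClass_eq g
  obtain ⟨y', hy', h⟩ := exists_liftsTo p.isSemicovering.pathLifting γ hy
  exact ⟨y', hy', p.imageSubgroup_eq_map_conj hy hy' h⟩

end ConnectedSemicovering

/-! ## Quotients that are étale over the base -/

section EtaleQuotient

theorem isLocalHomeomorph_of_isOpenMap {Y X : Type*} [TopologicalSpace Y] [TopologicalSpace X]
    {f : Y → X} (hc : Continuous f) (ho : IsOpenMap f) (hi : IsLocallyInjective f) :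
    IsLocalHomeomorph f := by
  refine isLocalHomeomorph_iff_isOpenEmbedding_restrict.2 fun y => ?_
  obtain ⟨U, hU, hy, hi⟩ := hi y
  exact ⟨U, hU.mem_nhds hy, .of_continuous_injective_isOpenMap (hc.comp continuous_subtype_val)
    (Set.injOn_iff_injective.1 hi) (ho.comp hU.isOpenMap_subtype_val)⟩

theorem exists_isOpen_of_rel {P X : Type*} [TopologicalSpace P] {S : Setoid P} {e : P → X}
    (hopen : ∀ α β, S α β → ∀ᶠ z in 𝓝 (α, β), e z.1 = e z.2 → S z.1 z.2) (α : P) :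
    ∃ A, IsOpen A ∧ α ∈ A ∧ ∀ a ∈ A, ∀ b ∈ A, e a = e b → S a b := by
  have h := hopen α α (S.refl α)
  rw [nhds_prod_eq] at h
  obtain ⟨T, hT, hTS⟩ := mem_prod_same_iff.1 h
  obtain ⟨A, hAT, hA, hα⟩ := mem_nhds_iff.1 hT
  exact ⟨A, hA, hα, fun a ha b hb => @hTS (a, b) ⟨hAT ha, hAT hb⟩⟩

variable {P : Type*} [TopologicalSpace P] {X : Type*} [TopologicalSpace X] {S : Setoid P}
  {e : P → X}

/-- Provides sheets of the quotient: on `A` the relation is just equality of `e`, so `e` is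
injective on the classes in `N`. Openness of `e` at `α` alone would not make `N` open; points of
openness are needed in `A` over all nearby values, which is the role of "locally" in locally
well-ended. -/
theorem exists_isOpen_sheet (he : Continuous e) (hS : ∀ α β, S α β → e α = e β)
    (hopen : ∀ α β, S α β → ∀ᶠ z in 𝓝 (α, β), e z.1 = e z.2 → S z.1 z.2) {α : P}
    (hα : IsLocallyOpenMapAt e α) {A : Set P} (hA : IsOpen A) (hαA : α ∈ A)
    (hAS : ∀ a ∈ A, ∀ b ∈ A, e a = e b → S a b) :
    ∃ N : Set (Quotient S), IsOpen N ∧ Quotient.mk S α ∈ N ∧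
      ∀ y ∈ N, ∃ β ∈ A, Quotient.mk S β = y := by
  obtain ⟨V, hVA, hV, hαV⟩ := mem_nhds_iff.1 (hα A (hA.mem_nhds hαA))
  refine ⟨{y | Quotient.lift e hS y ∈ V ∧ ∃ β ∈ A, Quotient.mk S β = y}, ?_,
    ⟨hαV, α, hαA, rfl⟩, fun y hy => hy.2⟩
  refine isOpen_coinduced.2 (isOpen_iff_mem_nhds.2 ?_)
  rintro ε ⟨hεV, β', hβ'A, hβ'⟩
  obtain ⟨β, hβA, hβ, hβe⟩ := hVA hεV
  have hβ'ε : S β' ε := Quotient.exact hβ'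
  -- Exchange the representative `β'` for `β`, at which `e` is open: both lie in `A` over the same
  -- point.
  have hεβ : S ε β :=
    S.trans (S.symm hβ'ε) (hAS _ hβ'A _ hβA ((hS _ _ hβ'ε).trans hβe.symm))
  have hev := hopen _ _ hεβ
  rw [nhds_prod_eq] at hev
  obtain ⟨E, hE, B, hB, hEB⟩ := mem_prod_iff.1 hev
  have hBA := hβ _ (inter_mem hB (hA.mem_nhds hβA))
  rw [hβe] at hBA
  filter_upwards [hE, he.continuousAt.eventually hBA, (hV.preimage he).mem_nhds hεV]
    with ε' hε' ⟨β₁, hβ₁, h₁⟩ hεV'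
  exact ⟨hεV', β₁, hβ₁.2, Quotient.sound (S.symm (hEB (Set.mk_mem_prod hε' hβ₁.1) h₁.symm))⟩

theorem isLocalHomeomorph_quotient_lift (he : Continuous e) (hS : ∀ α β, S α β → e α = e β)
    (hopen : ∀ α β, S α β → ∀ᶠ z in 𝓝 (α, β), e z.1 = e z.2 → S z.1 z.2)
    (hloc : ∀ α, ∃ α', S α' α ∧ IsLocallyOpenMapAt e α') :
    IsLocalHomeomorph (Quotient.lift e hS) := by
  refine isLocalHomeomorph_of_isOpenMap (he.quotient_lift hS)
    (isOpenMap_iff_nhds_le.2 fun y s hs => ?_) fun y => ?_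
  · obtain ⟨α, rfl⟩ := Quotient.exists_rep y
    obtain ⟨α', hα', h⟩ := hloc α
    rw [← Quotient.sound hα'] at hs ⊢
    filter_upwards [h.isOpenMapAt _ (continuous_quotient_mk'.continuousAt (mem_map.1 hs))]
      with b ⟨β, hβ, hb⟩
    exact hb ▸ hβ
  · obtain ⟨α, rfl⟩ := Quotient.exists_rep y
    obtain ⟨α', hα', h⟩ := hloc α
    rw [← Quotient.sound hα']
    obtain ⟨A, hA, hαA, hAS⟩ := exists_isOpen_of_rel hopen α'
    obtain ⟨N, hN, hαN, H⟩ := exists_isOpen_sheet he hS hopen h hA hαA hAS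
    refine ⟨N, hN, hαN, fun y₁ h₁ y₂ h₂ h₁₂ => ?_⟩
    obtain ⟨β₁, hβ₁, rfl⟩ := H _ h₁
    obtain ⟨β₂, hβ₂, rfl⟩ := H _ h₂
    exact Quotient.sound (hAS _ hβ₁ _ hβ₂ h₁₂)

theorem isSeparatedMap_quotient_lift (he : Continuous e) (hS : ∀ α β, S α β → e α = e β)
    (hopen : ∀ α β, S α β → ∀ᶠ z in 𝓝 (α, β), e z.1 = e z.2 → S z.1 z.2)
    (hclosed : ∀ α β, e α = e β → ¬ S α β → ∀ᶠ z in 𝓝 (α, β), ¬ S z.1 z.2)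
    (hloc : ∀ α, ∃ α', S α' α ∧ IsLocallyOpenMapAt e α') :
    IsSeparatedMap (Quotient.lift e hS) := by
  intro y₁ y₂ h hne
  obtain ⟨α₁, rfl⟩ := Quotient.exists_rep y₁
  obtain ⟨α₂, rfl⟩ := Quotient.exists_rep y₂
  obtain ⟨β₁, hβ₁, hl₁⟩ := hloc α₁
  obtain ⟨β₂, hβ₂, hl₂⟩ := hloc α₂
  rw [← Quotient.sound hβ₁, ← Quotient.sound hβ₂] at h hne ⊢
  have hev := hclosed β₁ β₂ h fun h' => hne (Quotient.sound h')
  rw [nhds_prod_eq] at hev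
  obtain ⟨T₁, hT₁, T₂, hT₂, hT⟩ := mem_prod_iff.1 hev
  obtain ⟨B₁, hBT₁, hB₁, hm₁⟩ := mem_nhds_iff.1 hT₁
  obtain ⟨B₂, hBT₂, hB₂, hm₂⟩ := mem_nhds_iff.1 hT₂
  obtain ⟨A₁, hA₁, hαA₁, hAS₁⟩ := exists_isOpen_of_rel hopen β₁
  obtain ⟨A₂, hA₂, hαA₂, hAS₂⟩ := exists_isOpen_of_rel hopen β₂
  obtain ⟨N₁, hN₁, hαN₁, H₁⟩ := exists_isOpen_sheet he hS hopen hl₁ (hA₁.inter hB₁) ⟨hαA₁, hm₁⟩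
    fun a ha b hb => hAS₁ a ha.1 b hb.1
  obtain ⟨N₂, hN₂, hαN₂, H₂⟩ := exists_isOpen_sheet he hS hopen hl₂ (hA₂.inter hB₂) ⟨hαA₂, hm₂⟩
    fun a ha b hb => hAS₂ a ha.1 b hb.1
  refine ⟨N₁, N₂, hN₁, hN₂, hαN₁, hαN₂, Set.disjoint_left.2 fun y h₁ h₂ => ?_⟩
  obtain ⟨γ₁, hγ₁, rfl⟩ := H₁ _ h₁
  obtain ⟨γ₂, hγ₂, h'⟩ := H₂ _ h₂
  exact hT (Set.mk_mem_prod (hBT₁ hγ₁.2) (hBT₂ hγ₂.2)) (S.symm (Quotient.exact h'))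

end EtaleQuotient

/-! ## Lifting of homotopies from lifting of paths -/

section HomotopyLifting

variable {X : Type u} [TopologicalSpace X] {Y : Type v} [TopologicalSpace Y] {p : C(Y, X)}

instance : CompactSpace Triangle :=
  isCompact_iff_compactSpace.1 (isClosed_le (f := fun z : I × I => (z.1 : ℝ) + (z.2 : ℝ))
    (by fun_prop) continuous_const).isCompact

/-- The horizontal retraction of the square onto the triangle. -/
def triangleRetraction (z : I × I) : Triangle :=
  ⟨(min z.1 (σ z.2), z.2), by
    have : ((min z.1 (σ z.2) : I) : ℝ) ≤ (σ z.2 : I) := Subtype.coe_le_coe.2 (min_le_right _ _)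
    rw [unitInterval.coe_symm_eq] at this
    change ((min z.1 (σ z.2) : I) : ℝ) + z.2 ≤ 1
    linarith⟩

theorem continuous_triangleRetraction : Continuous triangleRetraction := by
  unfold triangleRetraction
  fun_prop

theorem triangleRetraction_coe (z : Triangle) : triangleRetraction z.1 = z := by
  have : z.1.1 ≤ σ z.1.2 := by
    rw [← Subtype.coe_le_coe, unitInterval.coe_symm_eq]
    linarith [z.2]
  exact Subtype.ext (Prod.ext (min_eq_left this) rfl)

/-- The horizontal paths of a homotopy. -/
def rowPath {x : X} (φ : HomotopiesFrom x) (t : I) : PathsFrom x :=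
  ⟨⟨fun s => φ.1 (triangleRetraction (s, t)),
    φ.1.continuous.comp (continuous_triangleRetraction.comp (by fun_prop))⟩,
    φ.2 _ (min_eq_left unitInterval.nonneg')⟩

theorem continuous_rowPath {x : X} :
    Continuous fun z : HomotopiesFrom x × I => rowPath z.1 z.2 := by
  refine Continuous.subtype_mk (ContinuousMap.continuous_of_continuous_uncurry _ ?_) _
  change Continuous fun w : (HomotopiesFrom x × I) × I => w.1.1.1 (triangleRetraction (w.2, w.1.2))
  have := continuous_triangleRetraction
  fun_prop

theorem rowPath_apply {x : X} (φ : HomotopiesFrom x) (z : Triangle) :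
    (rowPath φ z.1.2).1 z.1.1 = φ.1 z :=
  congrArg φ.1 (triangleRetraction_coe z)

theorem continuous_pathsMap (p : C(Y, X)) (y : Y) : Continuous (pathsMap p y) :=
  Continuous.subtype_mk ((ContinuousMap.continuous_postcomp p).comp continuous_subtype_val) _

theorem continuous_homotopiesMap (p : C(Y, X)) (y : Y) : Continuous (homotopiesMap p y) :=
  Continuous.subtype_mk ((ContinuousMap.continuous_postcomp p).comp continuous_subtype_val) _

theorem isHomeomorph_of_injective_of_rightInverse {A B : Type*} [TopologicalSpace A]
    [TopologicalSpace B] {f : A → B} {g : B → A} (hf : Continuous f) (hi : f.Injective)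
    (hg : Continuous g) (h : Function.RightInverse g f) : IsHomeomorph f :=
  isHomeomorph_iff_exists_inverse.2 ⟨hf, g, h.leftInverse_of_injective hi, h, hg⟩

/-- Each horizontal row of the triangle, prolonged by a constant, is a path from the fixed point.
Lifting all rows is jointly continuous in the homotopy and the height. -/
theorem HasContinuousPathLifting.homotopyLifting (hp : HasContinuousPathLifting p) :
    HasContinuousHomotopyLifting p := by
  intro y
  let h := (hp y).homeomorph
  have hh : ∀ α, pathsMap p y (h.symm α) = α := h.apply_symm_apply
  have hc : Continuous fun w : HomotopiesFrom (p y) × Triangle =>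
      (h.symm (rowPath w.1 w.2.1.2)).1 w.2.1.1 := by
    have h₁ : Continuous fun w : HomotopiesFrom (p y) × Triangle => rowPath w.1 w.2.1.2 :=
      continuous_rowPath.comp (f := fun w : HomotopiesFrom (p y) × Triangle => (w.1, w.2.1.2))
        (by fun_prop)
    fun_prop
  let g : HomotopiesFrom (p y) → HomotopiesFrom y := fun φ =>
    ⟨⟨fun z => (h.symm (rowPath φ z.1.2)).1 z.1.1, hc.comp (Continuous.prodMk_right φ)⟩,
      fun z hz => by
        change (h.symm (rowPath φ z.1.2)).1 z.1.1 = y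
        rw [hz, (h.symm _).2]⟩
  refine isHomeomorph_of_injective_of_rightInverse (g := g) (continuous_homotopiesMap p y)
    (fun φ ψ hφψ => ?_)
    (Continuous.subtype_mk (ContinuousMap.continuous_of_continuous_uncurry _ hc) _) fun φ => ?_
  · refine Subtype.ext (ContinuousMap.ext fun z => ?_)
    rw [← rowPath_apply φ, ← rowPath_apply ψ, (hp y).injective (a₁ := rowPath φ z.1.2)
      (a₂ := rowPath ψ z.1.2) (congrArg (fun χ => rowPath χ z.1.2) hφψ)]
  · refine Subtype.ext (ContinuousMap.ext fun z => ?_)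
    rw [← rowPath_apply φ z]
    exact congrArg (fun α : PathsFrom (p y) => α.1 z.1.1) (hh (rowPath φ z.1.2))

/-- Two lifts agree on a set that is open by local injectivity and closed by separatedness. -/
theorem injective_pathsMap (hs : IsSeparatedMap p) (hi : IsLocallyInjective p) (y : Y) :
    (pathsMap p y).Injective := fun α β h =>
  Subtype.ext (DFunLike.coe_injective (hs.eq_of_comp_eq hi α.1.continuous β.1.continuous
    (funext fun t => congrArg (fun φ : PathsFrom (p y) => φ.1 t) h) 0 (α.2.trans β.2.symm)))

end HomotopyLifting

/-! ## The semicovering of an open subgroup -/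

section SubgroupSemicovering

variable {X : Type u} [TopologicalSpace X] {x₀ x : X}

/-- The loop running along the first path and back along the second one. -/
noncomputable def pathDifference (α β : PathsFrom x₀) (h : pathEnd β = pathEnd α) : Path x₀ x₀ :=
  (pathOf α rfl).trans (pathOf β h).symm

theorem pathDifference_eq {α β : PathsFrom x₀} (hα : pathEnd α = x) (hβ : pathEnd β = x) :
    pathDifference α β (hβ.trans hα.symm) = (pathOf α hα).trans (pathOf β hβ).symm := by
  subst hα
  rfl

/-- The difference loop is continuous on the space of pairs with a common endpoint. Applied to the
loops in `H` and to those outside it, this makes `moduloSetoid` relatively open and closed. -/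
theorem eventually_pathDifference_mem {W : Set (Path x₀ x₀)} (hW : IsOpen W) {α β : PathsFrom x₀}
    (h : pathEnd β = pathEnd α) (hαβ : pathDifference α β h ∈ W) :
    ∀ᶠ z in 𝓝 (α, β), ∀ h' : pathEnd z.2 = pathEnd z.1, pathDifference z.1 z.2 h' ∈ W := by
  let T := {z : PathsFrom x₀ × PathsFrom x₀ // pathEnd z.2 = pathEnd z.1}
  have hc : Continuous fun z : T => pathDifference z.1.1 z.1.2 z.2 :=
    Path.continuous_uncurry_iff.1 <| Path.trans_continuous_family _
      (continuous_pathOf (by fun_prop) _) _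
      (Path.symm_continuous_family _ (continuous_pathOf (by fun_prop) _))
  obtain ⟨U, hU, hUW⟩ := isOpen_induced_iff.1 (hW.preimage hc)
  have hmem : ∀ z : T, z.1 ∈ U ↔ pathDifference z.1.1 z.1.2 z.2 ∈ W := fun z => Set.ext_iff.1 hUW z
  filter_upwards [hU.mem_nhds ((hmem ⟨(α, β), h⟩).2 hαβ)] with z hz h'
  exact (hmem ⟨z, h'⟩).1 hz

/-- Two paths from `x₀` are equivalent if they have the same endpoint and the difference of their
homotopy classes lies in `H`. -/
def moduloSetoid (H : Subgroup (FundamentalGroup X x₀)) : Setoid (PathsFrom x₀) where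
  r α β := ∃ h : pathEnd β = pathEnd α, loopClass (pathDifference α β h) ∈ H
  iseqv :=
    { refl := fun α => ⟨rfl, by
        rw [pathDifference, loopClass_trans_symm_self]; exact H.one_mem⟩
      symm := fun {α β} ⟨h, hH⟩ => ⟨h.symm, by
        rw [pathDifference_eq rfl h] at hH
        rw [pathDifference_eq h rfl, ← loopClass_trans_symm_inv]
        exact H.inv_mem hH⟩
      trans := fun {α β γ} ⟨h, hH⟩ ⟨h', hH'⟩ => ⟨h'.trans h, by
        rw [pathDifference_eq rfl h] at hH
        rw [pathDifference_eq h (h'.trans h)] at hH'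
        rw [pathDifference_eq rfl (h'.trans h), ← loopClass_trans_symm_mul _ (pathOf β h)]
        exact H.mul_mem hH' hH⟩ }

variable {H : Subgroup (FundamentalGroup X x₀)}

theorem moduloSetoid_toPathsFrom_iff {a b : Path x₀ x} :
    moduloSetoid H a.toPathsFrom b.toPathsFrom ↔ loopClass (a.trans b.symm) ∈ H := by
  have h : pathDifference a.toPathsFrom b.toPathsFrom (b.target.trans a.target.symm) =
    a.trans b.symm :=
    pathDifference_eq (α := a.toPathsFrom) (β := b.toPathsFrom) a.target b.target
  rw [← h]
  exact ⟨fun h => h.2, fun h => ⟨_, h⟩⟩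

theorem moduloSetoid_of_homotopic {a b : Path x₀ x} (h : a.Homotopic b) :
    moduloSetoid H a.toPathsFrom b.toPathsFrom := by
  rw [moduloSetoid_toPathsFrom_iff]
  have : (a.trans b.symm).Homotopic (b.trans b.symm) := h.hcomp (.refl _)
  rw [loopClass_eq_iff.2 this, loopClass_trans_symm_self]
  exact H.one_mem

theorem moduloSetoid_pathEnd {α β : PathsFrom x₀} (h : moduloSetoid H α β) :
    pathEnd α = pathEnd β :=
  h.1.symm

variable (H) in
/-- The space of paths from `x₀` modulo an open subgroup of the fundamental group. -/
abbrev SubgroupSpace : Type u := Quotient (moduloSetoid H)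

variable (H) in
/-- The endpoint projection. -/
def subgroupProj : C(SubgroupSpace H, X) :=
  ⟨Quotient.lift pathEnd fun _ _ => moduloSetoid_pathEnd, continuous_pathEnd.quotient_lift _⟩

theorem eventually_moduloSetoid (hH : IsOpen {γ : Path x₀ x₀ | loopClass γ ∈ H})
    (α β : PathsFrom x₀) (h : moduloSetoid H α β) :
    ∀ᶠ z in 𝓝 (α, β), pathEnd z.1 = pathEnd z.2 → moduloSetoid H z.1 z.2 := by
  filter_upwards [eventually_pathDifference_mem hH h.1 h.2] with z hz he
  exact ⟨he.symm, hz he.symm⟩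

theorem eventually_not_moduloSetoid (hH : IsOpen {γ : Path x₀ x₀ | loopClass γ ∉ H})
    (α β : PathsFrom x₀) (he : pathEnd α = pathEnd β) (h : ¬ moduloSetoid H α β) :
    ∀ᶠ z in 𝓝 (α, β), ¬ moduloSetoid H z.1 z.2 := by
  filter_upwards [eventually_pathDifference_mem hH he.symm fun h' => h ⟨_, h'⟩] with z hz h'
  exact hz h'.1 h'.2

theorem LocallyWepConnected.exists_moduloSetoid (hX : LocallyWepConnected X) (α : PathsFrom x₀) :
    ∃ α', moduloSetoid H α' α ∧ IsLocallyOpenMapAt pathEnd α' := by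
  obtain ⟨γ, hh, hγ⟩ := hX.exists_homotopic (pathOf α rfl)
  exact ⟨_, moduloSetoid_of_homotopic hh.symm, hγ⟩

/-- The initial segment of a path. -/
def initialSegment (α : PathsFrom x) (t : I) : PathsFrom x :=
  ⟨⟨fun s => α.1 (t * s), by fun_prop⟩, by
    change α.1 (t * 0) = x
    rw [mul_zero, α.2]⟩

theorem continuous_initialSegment :
    Continuous fun z : PathsFrom x × I => initialSegment z.1 z.2 := by
  refine Continuous.subtype_mk (ContinuousMap.continuous_of_continuous_uncurry _ ?_) _
  change Continuous fun w : (PathsFrom x × I) × I => w.1.1.1 (w.1.2 * w.2)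
  fun_prop

theorem initialSegment_zero (α : PathsFrom x) :
    initialSegment α 0 = (Path.refl x).toPathsFrom := by
  refine Subtype.ext (ContinuousMap.ext fun s => ?_)
  change α.1 (0 * s) = x
  rw [zero_mul, α.2]

theorem initialSegment_one (α : PathsFrom x) : initialSegment α 1 = α := by
  refine Subtype.ext (ContinuousMap.ext fun s => ?_)
  change α.1 (1 * s) = α.1 s
  rw [one_mul]

theorem pathEnd_initialSegment (α : PathsFrom x) (t : I) :
    pathEnd (initialSegment α t) = α.1 t := by
  change α.1 (t * 1) = α.1 t
  rw [mul_one]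

theorem isSemicovering_subgroupProj (hX : LocallyWepConnected X)
    (hH : IsTauOpen X x₀ (H : Set (FundamentalGroup X x₀))) : IsSemicovering (subgroupProj H) := by
  have hopen := eventually_moduloSetoid ((isTauOpen_iff H).1 hH)
  have hclosed := eventually_not_moduloSetoid (isTauClosed_of_isTauOpen H hH)
  have hlh : IsLocalHomeomorph (subgroupProj H) :=
    isLocalHomeomorph_quotient_lift continuous_pathEnd _ hopen hX.exists_moduloSetoid
  have hsep : IsSeparatedMap (subgroupProj H) :=
    isSeparatedMap_quotient_lift continuous_pathEnd _ hopen hclosed hX.exists_moduloSetoid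
  have hlift : HasContinuousPathLifting (subgroupProj H) := by
    intro y
    obtain ⟨δ, rfl⟩ := Quotient.exists_rep y
    let d : Path x₀ (subgroupProj H (Quotient.mk _ δ)) := pathOf δ rfl
    have hc : Continuous fun z : PathsFrom (subgroupProj H (Quotient.mk _ δ)) × I =>
        Quotient.mk (moduloSetoid H) (prependPath d (initialSegment z.1 z.2)) :=
      continuous_quotient_mk'.comp ((continuous_prependPath d).comp continuous_initialSegment)
    have hstart : ∀ α : PathsFrom (subgroupProj H (Quotient.mk _ δ)),
        Quotient.mk (moduloSetoid H) (prependPath d (initialSegment α 0)) = Quotient.mk _ δ := by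
      intro α
      rw [initialSegment_zero]
      exact Quotient.sound (moduloSetoid_of_homotopic (a := d.trans (Path.refl _)) (b := d)
        (Path.Homotopic.Quotient.eq.1 (by simp)))
    -- The lift of `α` from the class of `δ` is, at time `t`, the class of `δ` followed by `α` up to
    -- time `t`.
    refine isHomeomorph_of_injective_of_rightInverse
      (g := fun α => ⟨⟨fun t => Quotient.mk _ (prependPath d (initialSegment α t)),
        hc.comp (Continuous.prodMk_right α)⟩, hstart α⟩)
      (continuous_pathsMap _ _) (injective_pathsMap hsep hlh.isLocallyInjective _)
      (Continuous.subtype_mk (ContinuousMap.continuous_of_continuous_uncurry _ hc) _) fun α => ?_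
    refine Subtype.ext (ContinuousMap.ext fun t => ?_)
    change pathEnd (prependPath d (initialSegment α t)) = α.1 t
    rw [pathEnd_prependPath, pathEnd_initialSegment]
  exact ⟨hlh, hlift, hlift.homotopyLifting⟩

variable (H) in
theorem liftsTo_subgroupProj (α : PathsFrom x₀) :
    LiftsTo (subgroupProj H) α.1 (Quotient.mk _ (Path.refl x₀).toPathsFrom) (Quotient.mk _ α) :=
  ⟨⟨⟨fun t => Quotient.mk _ (initialSegment α t), continuous_quotient_mk'.comp
      (continuous_initialSegment.comp (Continuous.prodMk_right α))⟩,
    congrArg (Quotient.mk _) (initialSegment_zero α),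
    congrArg (Quotient.mk _) (initialSegment_one α)⟩, pathEnd_initialSegment α⟩

/-- The connected semicovering defined by an open subgroup. -/
def subgroupSemicovering (hX : LocallyWepConnected X)
    (hH : IsTauOpen X x₀ (H : Set (FundamentalGroup X x₀))) : ConnectedSemicovering X where
  space := SubgroupSpace H
  proj := subgroupProj H
  isSemicovering := isSemicovering_subgroupProj hX hH
  pathConnected :=
    have hj : ∀ y, Joined (Quotient.mk (moduloSetoid H) (Path.refl x₀).toPathsFrom) y := fun y => by
      obtain ⟨α, rfl⟩ := Quotient.exists_rep y
      exact ⟨(liftsTo_subgroupProj H α).choose⟩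
    { nonempty := ⟨Quotient.mk _ (Path.refl x₀).toPathsFrom⟩
      joined := fun y z => (hj y).symm.trans (hj z) }

/-- The class of the constant path. -/
def subgroupBase (hX : LocallyWepConnected X)
    (hH : IsTauOpen X x₀ (H : Set (FundamentalGroup X x₀))) : (subgroupSemicovering hX hH).space :=
  Quotient.mk (moduloSetoid H) (Path.refl x₀).toPathsFrom

theorem proj_subgroupBase (hX : LocallyWepConnected X)
    (hH : IsTauOpen X x₀ (H : Set (FundamentalGroup X x₀))) :
    (subgroupSemicovering hX hH).proj (subgroupBase hX hH) = x₀ := rfl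

/-- The lift of a loop `γ` from the base point ends at the class of `γ`, which is the base point
exactly when `[γ] ∈ H`. -/
theorem imageSubgroup_subgroupSemicovering (hX : LocallyWepConnected X)
    (hH : IsTauOpen X x₀ (H : Set (FundamentalGroup X x₀))) :
    (subgroupSemicovering hX hH).imageSubgroup _ (proj_subgroupBase hX hH) = H := by
  ext g
  obtain ⟨γ, rfl⟩ := exists_loopClass_eq g
  have hγ := liftsTo_subgroupProj H γ.toPathsFrom
  have h1 : loopClass (γ.trans (Path.refl x₀).symm) = loopClass γ :=
    loopClass_eq_iff.2 (Path.Homotopic.Quotient.eq.1 (by simp))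
  refine (ConnectedSemicovering.loopClass_mem_imageSubgroup _ (proj_subgroupBase hX hH)).trans ?_
  rw [← h1, ← moduloSetoid_toPathsFrom_iff]
  constructor
  · intro h
    exact Quotient.exact (hγ.target_unique (isSemicovering_subgroupProj hX hH).pathLifting h)
  · intro h
    have h' := Quotient.sound h
    rwa [h'] at hγ

end SubgroupSemicovering

/-! ## The Galois correspondence -/

section Galois

variable {X : Type u} [TopologicalSpace X] {x₀ : X}

open ConnectedSemicovering

theorem OpenSubgroupConjClasses.mk_eq_iff {H K : OpenSubgroups X x₀} :
    (Quotient.mk _ H : OpenSubgroupConjClasses X x₀) = Quotient.mk _ K ↔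
      ∃ g : FundamentalGroup X x₀, K.1 = H.1.map (MulAut.conj g).toMonoidHom :=
  Quotient.eq

theorem ConnectedSemicovering.exists_map_conj_of_hom (p q : ConnectedSemicovering X)
    {y : p.space} (hy : p.proj y = x₀) {z : q.space} (hz : q.proj z = x₀) (f : p.Hom q)
    (hX : LocallyWepConnected X) : ∃ g : FundamentalGroup X x₀,
      p.imageSubgroup y hy ≤ (q.imageSubgroup z hz).map (MulAut.conj g).toMonoidHom := by
  have hfy : q.proj (f.1 y) = x₀ := by rw [← ContinuousMap.comp_apply, f.2, hy]
  obtain ⟨g, hg⟩ := q.exists_imageSubgroup_eq_map_conj hz hfy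
  exact ⟨g, hg ▸ (exists_hom_iff hX p q hy hfy).1 ⟨f.1, f.2, rfl⟩⟩

theorem ConnectedSemicovering.nonempty_hom_iff (hX : LocallyWepConnected X)
    (p q : ConnectedSemicovering X) {y : p.space} (hy : p.proj y = x₀) {z : q.space}
    (hz : q.proj z = x₀) : Nonempty (p.Hom q) ↔ ∃ g : FundamentalGroup X x₀,
      p.imageSubgroup y hy ≤ (q.imageSubgroup z hz).map (MulAut.conj g).toMonoidHom := by
  refine ⟨fun ⟨f⟩ => p.exists_map_conj_of_hom q hy hz f hX, fun ⟨g, hg⟩ => ?_⟩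
  obtain ⟨z', hz', h⟩ := q.exists_map_conj_eq_imageSubgroup hz g
  obtain ⟨f, hf, -⟩ := (exists_hom_iff hX p q hy hz').2 (h ▸ hg)
  exact ⟨f, hf⟩

theorem ConnectedSemicovering.equivalent_iff (hX : LocallyWepConnected X)
    (p q : ConnectedSemicovering X) {y : p.space} (hy : p.proj y = x₀) {z : q.space}
    (hz : q.proj z = x₀) : Equivalent p q ↔ ∃ g : FundamentalGroup X x₀,
      q.imageSubgroup z hz = (p.imageSubgroup y hy).map (MulAut.conj g).toMonoidHom := by
  constructor
  · rintro ⟨f, hf⟩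
    have hfy : q.proj (f y) = x₀ := (hf y).trans hy
    obtain ⟨g, hg⟩ := q.exists_imageSubgroup_eq_map_conj hfy hz
    refine ⟨g, hg.trans (congrArg _ (le_antisymm ?_ ?_))⟩
    · refine (exists_hom_iff hX q p hfy hy).1
        ⟨⟨f.symm, f.symm.continuous⟩, ?_, f.symm_apply_apply y⟩
      ext w
      change p.proj (f.symm w) = q.proj w
      rw [← hf, f.apply_symm_apply]
    · exact (exists_hom_iff hX p q hy hfy).1 ⟨⟨f, f.continuous⟩, ContinuousMap.ext hf, rfl⟩
  · rintro ⟨g, hg⟩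
    obtain ⟨y', hy', h⟩ := p.exists_map_conj_eq_imageSubgroup hy g
    exact equivalent_of_imageSubgroup_eq hX p q hy' hz (h.trans hg.symm)

theorem mul_map_conj_le_iff {G : Type u} [Group G] {H K H' K' : Subgroup G}
    (hH : ∃ a : G, H' = H.map (MulAut.conj a).toMonoidHom)
    (hK : ∃ b : G, K' = K.map (MulAut.conj b).toMonoidHom)
    (h : ∃ g : G, H ≤ K.map (MulAut.conj g).toMonoidHom) :
    ∃ g : G, H' ≤ K'.map (MulAut.conj g).toMonoidHom := by
  obtain ⟨a, rfl⟩ := hH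
  obtain ⟨b, rfl⟩ := hK
  obtain ⟨g, hg⟩ := h
  -- With `K' = bKb⁻¹`, conjugating `K'` by `agb⁻¹` gives `agK(ag)⁻¹`, which contains `aHa⁻¹`.
  refine ⟨a * g * b⁻¹, (Subgroup.map_mono hg).trans (le_of_eq ?_)⟩
  rw [Subgroup.map_map, Subgroup.map_map]
  congr 1
  ext k
  simp [mul_assoc]

end Galois

theorem mainTheorem6 {X : Type u} [TopologicalSpace X] (hX : LocallyWepConnected X) (x₀ : X) :
    ∃ Φ : ConnectedSemicovering.EquivalenceClasses X ≃ OpenSubgroupConjClasses X x₀,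
      (∀ p : ConnectedSemicovering X,
        (∃ y : p.space, p.proj y = x₀) ∧
        ∀ (y : p.space) (hy : p.proj y = x₀),
          ∃ hopen : IsTauOpen X x₀
              (p.imageSubgroup y hy : Set (FundamentalGroup X x₀)),
            Φ (Quotient.mk _ p) = Quotient.mk _ ⟨p.imageSubgroup y hy, hopen⟩) ∧
      (∀ (p q : ConnectedSemicovering X) (H K : OpenSubgroups X x₀),
        Φ (Quotient.mk _ p) = Quotient.mk _ H → Φ (Quotient.mk _ q) = Quotient.mk _ K →
          (Nonempty (p.Hom q) ↔
            ∃ g : FundamentalGroup X x₀, H.1 ≤ K.1.map (MulAut.conj g).toMonoidHom)) := by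
  choose b hb using fun p : ConnectedSemicovering X => p.exists_proj_eq hX x₀
  let im : ConnectedSemicovering X → OpenSubgroups X x₀ := fun p =>
    ⟨p.imageSubgroup (b p) (hb p), p.isTauOpen_imageSubgroup (hb p)⟩
  have him : ∀ p q, (Quotient.mk _ (im p) : OpenSubgroupConjClasses X x₀) = Quotient.mk _ (im q) ↔
      ConnectedSemicovering.Equivalent p q := fun p q =>
    OpenSubgroupConjClasses.mk_eq_iff.trans (p.equivalent_iff hX q (hb p) (hb q)).symm
  let φ : ConnectedSemicovering.EquivalenceClasses X → OpenSubgroupConjClasses X x₀ :=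
    Quotient.lift (fun p => Quotient.mk _ (im p)) fun p q h => (him p q).2 h
  have hφ : ∀ (p : ConnectedSemicovering X) (y : p.space) (hy : p.proj y = x₀),
      φ (Quotient.mk _ p) =
        Quotient.mk _ ⟨p.imageSubgroup y hy, p.isTauOpen_imageSubgroup hy⟩ := fun p y hy =>
    OpenSubgroupConjClasses.mk_eq_iff.2 (p.exists_imageSubgroup_eq_map_conj (hb p) hy)
  have hbij : φ.Bijective := by
    constructor
    · intro c d h
      obtain ⟨p, rfl⟩ := Quotient.exists_rep c
      obtain ⟨q, rfl⟩ := Quotient.exists_rep d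
      exact Quotient.sound ((him p q).1 h)
    · intro c
      obtain ⟨⟨H, hH⟩, rfl⟩ := Quotient.exists_rep c
      refine ⟨Quotient.mk _ (subgroupSemicovering hX hH),
        (hφ _ _ (proj_subgroupBase hX hH)).trans ?_⟩
      exact congrArg (Quotient.mk _) (Subtype.ext (imageSubgroup_subgroupSemicovering hX hH))
  refine ⟨Equiv.ofBijective φ hbij, fun p => ⟨⟨b p, hb p⟩, fun y hy => ⟨_, hφ p y hy⟩⟩,
    fun p q H K hH hK => ?_⟩
  have hH' := OpenSubgroupConjClasses.mk_eq_iff.1 hH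
  have hK' := OpenSubgroupConjClasses.mk_eq_iff.1 hK
  have hH'' := OpenSubgroupConjClasses.mk_eq_iff.1 hH.symm
  have hK'' := OpenSubgroupConjClasses.mk_eq_iff.1 hK.symm
  rw [p.nonempty_hom_iff hX q (hb p) (hb q)]
  -- `H` and `K` are arbitrary representatives of their classes, so the criterion at the chosen base
  -- points is carried over by conjugation.
  exact ⟨mul_map_conj_le_iff hH' hK', mul_map_conj_le_iff hH'' hK''⟩
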